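/- (Graham--Leeb--Rothschild theorem) Let $F$ be a finite field. For all $k, n, s \in \mathbb{N} = \{0, 1, 2, \dots\}$ there exists $m \in \mathbb{N}$ such that for every coloring $c$ of the set of $k$-dimensional linear subspaces of $F^m$ with colors $\{0, \dots, s-1\}$ (equivalently, every partition of that set into $s$ classes, some of which may be empty) there exist an $n$-dimensional linear subspace $V$ of $F^m$ and a color $i \in \{0, \dots, s-1\}$ such that $c(W) = i$ for every $k$-dimensional linear subspace $W$ of $F^m$ with $W \subseteq V$. -/

import Mathlib

/-!
Induction on `k`. By the Hales–Jewett theorem with alphabet the functionals on `M`, whose words of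
length `ι` are the linear maps `M → F ^ ι`, every coloring of the subspaces of `M × F ^ ι` has a
copy of `M × F` on which the color of a subspace `T` avoiding the vertical vector `(0, 1)` depends
only on the projection of `T` to `M`: such a `T` is a piece of the graph of a functional, and a
monochromatic line sends all functionals to the same color. The subspaces containing `(0, 1)` are
the products `W × F`, so the theorem for `k` makes those of dimension `k + 1` have one color `a`.
With a target dimension for each color, induction on the targets applies to the projected coloring
with the target for `a` lowered by one: it yields either a target in another color, or an
`a`-colored subspace `V` such that `V × F` is `a`-colored and one dimension larger.
-/

open Module Combinatorics

universe u v w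

section Projection

variable {F : Type u} [Field F] {M : Type v} [AddCommGroup M] [Module F M]

theorem exists_le_graph_of_notMem {T : Submodule F (M × F)} (hT : ((0, 1) : M × F) ∉ T) :
    ∃ g : M →ₗ[F] F, T ≤ g.graph := by
  have hker : LinearMap.ker ((LinearMap.fst F M F).domRestrict T) = ⊥ := by
    rw [LinearMap.ker_eq_bot']
    rintro ⟨⟨x, z⟩, hxz⟩ hx
    obtain rfl : x = 0 := by simpa using hx
    have hz : z = 0 := by
      by_contra hz
      exact hT (by simpa [hz] using T.smul_mem z⁻¹ hxz)
    simp [hz]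
  obtain ⟨r, hr⟩ := LinearMap.exists_leftInverse_of_injective _ hker
  refine ⟨LinearMap.snd F M F ∘ₗ T.subtype ∘ₗ r, fun t ht ↦ ?_⟩
  exact (congrArg (fun x : T ↦ (x : M × F).2) (LinearMap.congr_fun hr ⟨t, ht⟩)).symm

theorem map_prod_map_fst_of_le_graph {N : Type w} [AddCommGroup N] [Module F N]
    {g : M →ₗ[F] N} {T : Submodule F (M × N)} (hT : T ≤ g.graph) :
    (T.map (LinearMap.fst F M N)).map (LinearMap.id.prod g) = T := by
  have hid : ∀ t ∈ T, (t.1, g t.1) = t := fun t ht ↦ Prod.ext rfl (hT ht).symm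
  ext t
  constructor
  · rintro ⟨_, ⟨t, ht, rfl⟩, rfl⟩
    exact (hid t ht).symm ▸ ht
  · exact fun ht ↦ ⟨t.1, ⟨t, ht, rfl⟩, hid t ht⟩

theorem finrank_map_of_injective {N : Type w} [AddCommGroup N] [Module F N] {J : M →ₗ[F] N}
    (hJ : Function.Injective J) (W : Submodule F M) : finrank F (W.map J) = finrank F W :=
  (W.equivMapOfInjective J hJ).finrank_eq.symm

theorem finrank_map_fst_of_notMem {T : Submodule F (M × F)} (hT : ((0, 1) : M × F) ∉ T) :
    finrank F (T.map (LinearMap.fst F M F)) = finrank F T := by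
  obtain ⟨g, hg⟩ := exists_le_graph_of_notMem hT
  have hinj : Function.Injective (LinearMap.id.prod g) := fun x y h ↦ congrArg Prod.fst h
  rw [← finrank_map_of_injective hinj, map_prod_map_fst_of_le_graph hg]

theorem prod_top_map_fst_of_mem {T : Submodule F (M × F)} (hT : ((0, 1) : M × F) ∈ T) :
    (T.map (LinearMap.fst F M F)).prod ⊤ = T := by
  ext ⟨x, z⟩
  constructor
  · rintro ⟨⟨⟨x, y⟩, hxy, rfl⟩, -⟩
    simpa using T.add_mem hxy (T.smul_mem (z - y) hT)
  · exact fun h ↦ ⟨⟨(x, z), h, rfl⟩, trivial⟩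

theorem finrank_prod_top [FiniteDimensional F M] (W : Submodule F M) :
    finrank F (W.prod (⊤ : Submodule F F)) = finrank F W + 1 := by
  have hrange : LinearMap.range (W.subtype.prodMap (LinearMap.id : F →ₗ[F] F)) = W.prod ⊤ := by
    rw [LinearMap.range_prodMap, W.range_subtype, LinearMap.range_id]
  have hinj : Function.Injective (W.subtype.prodMap (LinearMap.id : F →ₗ[F] F)) :=
    W.injective_subtype.prodMap Function.injective_id
  rw [← hrange, LinearMap.finrank_range_of_inj hinj, finrank_prod, finrank_self]

end Projection

section Colorings

variable {F : Type u} [Field F] {κ : Type*} {k : ℕ} {i : κ}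
  {M E N : Type*} [AddCommGroup M] [Module F M] [AddCommGroup E] [Module F E]
  [AddCommGroup N] [Module F N]

/-- The coloring `c` gives all `k`-dimensional subspaces the color `i`. Colorings are defined on
subspaces of all dimensions, so that they can be pulled back along arbitrary linear maps. -/
def IsMonochromatic (c : Submodule F M → κ) (k : ℕ) (i : κ) : Prop :=
  ∀ W : Submodule F M, finrank F W = k → c W = i

theorem IsMonochromatic.comp_map {c : Submodule F E → κ} (hc : IsMonochromatic c k i)
    {J : M →ₗ[F] E} (hJ : Function.Injective J) :
    IsMonochromatic (fun W ↦ c (W.map J)) k i :=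
  fun W hW ↦ hc _ ((finrank_map_of_injective hJ W).trans hW)

/-- Some `n`-dimensional subspace has all its `k`-dimensional subspaces colored `i` by `c`. The
subspace is given as the image of an embedding of `F ^ n`, so that passing to a smaller space is
composition of embeddings. -/
def HasMonochromaticCopy (c : Submodule F E → κ) (k : ℕ) (i : κ) (n : ℕ) : Prop :=
  ∃ J : (Fin n → F) →ₗ[F] E, Function.Injective J ∧ IsMonochromatic (fun W ↦ c (W.map J)) k i

theorem exists_injective_pi_of_le_finrank [FiniteDimensional F E] {n : ℕ}
    (hn : n ≤ finrank F E) : ∃ J : (Fin n → F) →ₗ[F] E, Function.Injective J :=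
  finrank_le_iff_exists_linearMap.1 (by rwa [finrank_fin_fun])

theorem IsMonochromatic.hasMonochromaticCopy [FiniteDimensional F M] {c : Submodule F E → κ}
    {J : M →ₗ[F] E} (hc : IsMonochromatic (fun W ↦ c (W.map J)) k i)
    (hJ : Function.Injective J) {n : ℕ} (hn : n ≤ finrank F M) :
    HasMonochromaticCopy c k i n := by
  obtain ⟨K, hK⟩ := exists_injective_pi_of_le_finrank hn
  refine ⟨J ∘ₗ K, hJ.comp hK, ?_⟩
  simpa only [Submodule.map_comp] using hc.comp_map hK

theorem HasMonochromaticCopy.exists_submodule {c : Submodule F E → κ} {n : ℕ}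
    (h : HasMonochromaticCopy c k i n) :
    ∃ V : Submodule F E, finrank F V = n ∧ ∀ W ≤ V, finrank F W = k → c W = i := by
  obtain ⟨J, hJ, hc⟩ := h
  refine ⟨LinearMap.range J, ?_, fun W hWV hW ↦ ?_⟩
  · rw [LinearMap.finrank_range_of_inj hJ, finrank_fin_fun]
  · rw [← Submodule.map_comap_eq_of_le hWV] at hW ⊢
    exact hc _ ((finrank_map_of_injective hJ _).symm.trans hW)

variable (F E) in
/-- The partition relation `E → (f)^k`: every coloring of the subspaces of `E` has, for some color
`i`, a subspace of dimension `f i` all of whose `k`-dimensional subspaces have color `i`. -/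
def SubspaceArrows (k : ℕ) (f : κ → ℕ) : Prop :=
  ∀ c : Submodule F E → κ, ∃ i, HasMonochromaticCopy c k i (f i)

theorem SubspaceArrows.of_finrank_le [FiniteDimensional F E] [FiniteDimensional F N]
    {f : κ → ℕ} (h : SubspaceArrows F E k f) (hle : finrank F E ≤ finrank F N) :
    SubspaceArrows F N k f := by
  intro c
  obtain ⟨L, hL⟩ := finrank_le_iff_exists_linearMap.1 hle
  obtain ⟨i, J, hJ, hc⟩ := h fun W ↦ c (W.map L)
  exact ⟨i, L ∘ₗ J, hL.comp hJ, by simpa only [Submodule.map_comp] using hc⟩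

/-- Subspaces avoiding the vertical vector `(0, 1)` are colored by `c` according to the color
that `χ` gives to their projections to `M`. -/
def FactorsThroughFst (c : Submodule F (M × F) → κ) (χ : Submodule F M → κ) : Prop :=
  ∀ T : Submodule F (M × F), ((0, 1) : M × F) ∉ T → c T = χ (T.map (LinearMap.fst F M F))

namespace FactorsThroughFst

theorem comp_map {c : Submodule F (E × F) → κ} {χ : Submodule F E → κ}
    (h : FactorsThroughFst c χ) {L : M →ₗ[F] E} (hL : Function.Injective L) :
    FactorsThroughFst (fun T ↦ c (T.map (L.prodMap LinearMap.id))) fun W ↦ χ (W.map L) := by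
  intro T hT
  have hT' : ((0, 1) : E × F) ∉ T.map (L.prodMap LinearMap.id) := by
    rintro ⟨⟨x, z⟩, hxz, h⟩
    obtain ⟨hx, rfl⟩ : L x = 0 ∧ z = 1 := by simpa using h
    obtain rfl : x = 0 := hL (hx.trans L.map_zero.symm)
    exact hT hxz
  have hfst : LinearMap.fst F E F ∘ₗ L.prodMap LinearMap.id = L ∘ₗ LinearMap.fst F M F := rfl
  simp only [h _ hT', ← Submodule.map_comp, hfst]

theorem apply_map_inl {c : Submodule F (M × F) → κ} {χ : Submodule F M → κ}
    (h : FactorsThroughFst c χ) (W : Submodule F M) :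
    c (W.map (LinearMap.inl F M F)) = χ W := by
  rw [h _ (by simp), ← Submodule.map_comp, LinearMap.fst_comp_inl, Submodule.map_id]

theorem isMonochromatic_succ [FiniteDimensional F M] {c : Submodule F (M × F) → κ}
    {χ : Submodule F M → κ} (h : FactorsThroughFst c χ)
    (hprod : IsMonochromatic (fun W ↦ c (W.prod ⊤)) k i) (hχ : IsMonochromatic χ (k + 1) i) :
    IsMonochromatic c (k + 1) i := by
  intro T hTk
  by_cases hT : ((0, 1) : M × F) ∈ T
  · rw [← prod_top_map_fst_of_mem hT] at hTk ⊢
    rw [finrank_prod_top, Nat.add_right_cancel_iff] at hTk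
    exact hprod _ hTk
  · rw [h T hT]
    exact hχ _ ((finrank_map_fst_of_notMem hT).trans hTk)

end FactorsThroughFst

end Colorings

section HalesJewett

variable {F : Type u} [Field F] {M : Type v} [AddCommGroup M] [Module F M] {ι : Type*}

/-- The embedding of `M × F` into `M × F ^ ι` attached to a combinatorial line of functionals on
`M`: the coordinate `z` of `F` is copied to the moving positions, and a fixed position with letter
`a` gets the value of `a` on `M`. -/
def lineEmbedding (l : Line (M →ₗ[F] F) ι) : M × F →ₗ[F] M × (ι → F) :=
  (LinearMap.fst F M F).prod <| LinearMap.pi fun i ↦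
    (l.idxFun i).elim (LinearMap.snd F M F) fun a ↦ a ∘ₗ LinearMap.fst F M F

theorem lineEmbedding_injective (l : Line (M →ₗ[F] F) ι) :
    Function.Injective (lineEmbedding l) := by
  intro x y hxy
  obtain ⟨i, hi⟩ := l.proper
  have hfst : x.1 = y.1 := (Prod.ext_iff.1 hxy).1
  have hcoord := congrFun (Prod.ext_iff.1 hxy).2 i
  exact Prod.ext hfst (by simpa [lineEmbedding, hi] using hcoord)

theorem lineEmbedding_comp_prod (l : Line (M →ₗ[F] F) ι) (g : M →ₗ[F] F) :
    lineEmbedding l ∘ₗ LinearMap.id.prod g = LinearMap.id.prod (LinearMap.pi (l g)) := by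
  refine LinearMap.ext fun x ↦ Prod.ext rfl (funext fun i ↦ ?_)
  cases hi : l.idxFun i <;> simp [lineEmbedding, hi]

variable (F M) in
theorem exists_injective_factorsThroughFst [Finite F] [Finite M] (κ : Type w) [Finite κ] :
    ∃ (ι : Type) (_ : Fintype ι), ∀ c : Submodule F (M × (ι → F)) → κ,
      ∃ Ψ : M × F →ₗ[F] M × (ι → F), Function.Injective Ψ ∧
        ∃ χ : Submodule F M → κ, FactorsThroughFst (fun T ↦ c (T.map Ψ)) χ := by
  have : Finite (M →ₗ[F] F) := Finite.of_injective _ DFunLike.coe_injective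
  obtain ⟨ι, hι, hmono⟩ :=
    Line.exists_mono_in_high_dimension (M →ₗ[F] F) (Submodule F M → κ)
  refine ⟨ι, hι, fun c ↦ ?_⟩
  obtain ⟨l, χ, hχ⟩ := hmono fun x W ↦ c (W.map (LinearMap.id.prod (LinearMap.pi x)))
  refine ⟨lineEmbedding l, lineEmbedding_injective l, χ, fun T hT ↦ ?_⟩
  obtain ⟨g, hg⟩ := exists_le_graph_of_notMem hT
  calc c (T.map (lineEmbedding l))
      = c ((T.map (LinearMap.fst F M F)).map (LinearMap.id.prod (LinearMap.pi (l g)))) := by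
        rw [← lineEmbedding_comp_prod, Submodule.map_comp, map_prod_map_fst_of_le_graph hg]
    _ = χ (T.map (LinearMap.fst F M F)) := congrFun (hχ g) _

end HalesJewett

section Induction

variable {F : Type u} [Field F] {κ : Type v} {k : ℕ} {f : κ → ℕ}

theorem subspaceArrows_succ_of_eq_zero {i : κ} (hi : f i = 0) :
    SubspaceArrows F (Fin 0 → F) (k + 1) f := by
  refine fun c ↦ ⟨i, IsMonochromatic.hasMonochromaticCopy (J := LinearMap.id) ?_
    Function.injective_id (by simp [hi])⟩
  intro W hW
  rw [Subsingleton.elim W ⊥, finrank_bot] at hW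
  exact absurd hW k.succ_ne_zero.symm

theorem exists_subspaceArrows_zero [Finite κ] (f : κ → ℕ) :
    ∃ m, SubspaceArrows F (Fin m → F) 0 f := by
  obtain ⟨m, hm⟩ := Finite.bddAbove_range f
  refine ⟨m, fun c ↦ ⟨c ⊥, IsMonochromatic.hasMonochromaticCopy (J := LinearMap.id) ?_
    Function.injective_id (by simpa using hm ⟨c ⊥, rfl⟩)⟩⟩
  intro W hW
  simp only [Submodule.finrank_eq_zero.1 hW, Submodule.map_bot]

theorem exists_subspaceArrows_succ_of_update [Finite F] [Finite κ] [DecidableEq κ] {d N : ℕ}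
    (hd : SubspaceArrows F (Fin d → F) k fun _ : κ ↦ N)
    (hN : ∀ a, SubspaceArrows F (Fin N → F) (k + 1) (Function.update f a (f a - 1))) :
    ∃ m, SubspaceArrows F (Fin m → F) (k + 1) f := by
  obtain ⟨ι, _, hι⟩ := exists_injective_factorsThroughFst F (Fin d → F) κ
  suffices SubspaceArrows F ((Fin d → F) × (ι → F)) (k + 1) f from
    ⟨_, this.of_finrank_le (finrank_fin_fun F).ge⟩
  intro c
  obtain ⟨Ψ, hΨ, χ, hχ⟩ := hι c
  obtain ⟨a, J, hJ, hJa⟩ := hd fun W ↦ c ((W.prod ⊤).map Ψ)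
  obtain ⟨i, K, hK, hKi⟩ := hN a fun W ↦ χ (W.map J)
  have hL : Function.Injective (J ∘ₗ K) := hJ.comp hK
  have hfactors := hχ.comp_map hL
  have hχi : IsMonochromatic (fun W ↦ χ (W.map (J ∘ₗ K))) (k + 1) i := by
    simpa only [Submodule.map_comp] using hKi
  refine ⟨i, ?_⟩
  obtain rfl | hia := eq_or_ne i a
  · have hprod : IsMonochromatic
        (fun W ↦ c (((W.prod ⊤).map ((J ∘ₗ K).prodMap LinearMap.id)).map Ψ)) k i := by
      simpa only [LinearMap.prodMap_map_prod, Submodule.map_comp, Submodule.map_id]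
        using hJa.comp_map hK
    have hsucc := hfactors.isMonochromatic_succ hprod hχi
    simp only [← Submodule.map_comp] at hsucc
    refine hsucc.hasMonochromaticCopy
      (hΨ.comp (hL.prodMap Function.injective_id)) ?_
    rw [finrank_prod, finrank_fin_fun, finrank_self, Function.update_self]
    omega
  · simp only [← hfactors.apply_map_inl, ← Submodule.map_comp] at hχi
    refine hχi.hasMonochromaticCopy
      (hΨ.comp ((hL.prodMap Function.injective_id).comp LinearMap.inl_injective)) ?_
    rw [finrank_fin_fun, Function.update_of_ne hia]

theorem exists_subspaceArrows_succ [Finite F] [Finite κ]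
    (ih : ∀ N, ∃ d, SubspaceArrows F (Fin d → F) k fun _ : κ ↦ N) (f : κ → ℕ) :
    ∃ m, SubspaceArrows F (Fin m → F) (k + 1) f := by
  classical
  induction f using WellFoundedLT.induction with
  | ind f ihf =>
    by_cases hf : ∃ i, f i = 0
    · obtain ⟨i, hi⟩ := hf
      exact ⟨0, subspaceArrows_succ_of_eq_zero hi⟩
    push Not at hf
    choose M hM using fun a ↦ ihf (Function.update f a (f a - 1))
      (update_lt_self_iff.2 (Nat.sub_one_lt (hf a)))
    obtain ⟨N, hN⟩ := Finite.bddAbove_range M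
    obtain ⟨d, hd⟩ := ih N
    exact exists_subspaceArrows_succ_of_update hd fun a ↦
      (hM a).of_finrank_le (by simpa using hN ⟨a, rfl⟩)

theorem exists_subspaceArrows [Finite F] [Finite κ] (k : ℕ) (f : κ → ℕ) :
    ∃ m, SubspaceArrows F (Fin m → F) k f := by
  induction k generalizing f with
  | zero => exact exists_subspaceArrows_zero f
  | succ k ih => exact exists_subspaceArrows_succ (fun N ↦ ih fun _ ↦ N) f

end Induction

theorem mainTheorem7_general (F : Type u) [Field F] [Finite F] {κ : Type v} [Finite κ] (k : ℕ)
    (f : κ → ℕ) :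
    ∃ m : ℕ, ∀ (E : Type w) [AddCommGroup E] [Module F E] [FiniteDimensional F E],
      m ≤ finrank F E → ∀ c : {W : Submodule F E // finrank F W = k} → κ,
        ∃ (i : κ) (V : Submodule F E), finrank F V = f i ∧
          ∀ W : {W : Submodule F E // finrank F W = k}, W.1 ≤ V → c W = i := by
  obtain ⟨m, hm⟩ := exists_subspaceArrows (F := F) k f
  refine ⟨max m k, fun E _ _ _ hE c ↦ ?_⟩
  have harrows : SubspaceArrows F E k f :=
    hm.of_finrank_le (by simpa using (le_max_left m k).trans hE)
  obtain ⟨J, hJ⟩ := exists_injective_pi_of_le_finrank ((le_max_right m k).trans hE)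
  let W₀ : {W : Submodule F E // finrank F W = k} :=
    ⟨LinearMap.range J, by rw [LinearMap.finrank_range_of_inj hJ, finrank_fin_fun]⟩
  obtain ⟨i, hi⟩ := harrows (Function.extend Subtype.val c fun _ ↦ c W₀)
  obtain ⟨V, hV, hcV⟩ := hi.exists_submodule
  refine ⟨i, V, hV, fun W hWV ↦ ?_⟩
  rw [← hcV W.1 hWV W.2, Subtype.val_injective.extend_apply]

theorem mainTheorem7 (F : Type*) [Field F] [Finite F] (k n s : ℕ) :
    ∃ m : ℕ, ∀ c : {W : Submodule F (Fin m → F) // Module.finrank F W = k} → Fin s,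
      ∃ V : Submodule F (Fin m → F), Module.finrank F V = n ∧
        ∃ i : Fin s, ∀ W : {W : Submodule F (Fin m → F) // Module.finrank F W = k},
          W.1 ≤ V → c W = i := by
  obtain ⟨m, hm⟩ := mainTheorem7_general F k fun _ : Fin s ↦ n
  exact ⟨m, fun c ↦ let ⟨i, V, hV, hc⟩ := hm _ (finrank_fin_fun F).ge c; ⟨V, hV, i, hc⟩⟩
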